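/- **Setting.** Let $\mathcal C$ be any set, $S\subseteq\mathbb R^q$ with its Borel $\sigma$-algebra, $\mathcal P(S)$ the set of Borel probability measures on $S$ with the topology of weak convergence, $\alpha,\beta>0$, and $G^0_{\mathbf c}\in\mathcal P(S)$ for $\mathbf c\in\mathcal C$. Suppose that all $G^0_{\mathbf c}$ have the same support $\Theta\subseteq S$. *Copulas.* Let $\Psi$ be a family of copulas $\psi_{x_1,\dots,x_d}$, one for each finite tuple of distinct points of $\mathcal X=\mathcal C\times\{1,\dots,r\}$, that is invariant under simultaneous permutation of points and arguments, and such that setting the argument at $x_k$ to $1$ gives the copula of the tuple without $x_k$. An $S$-valued process $\boldsymbol\theta$ on $\mathcal C$ has finite-dimensional distributions determined by $\Psi$ and $(G^0_{\mathbf c})$ if $\boldsymbol\theta(\mathbf c)\sim G^0_{\mathbf c}$ for all $\mathbf c$ and $\boldsymbol\theta$ has the same law as $\mathbf c\mapsto h_{\mathbf c}(Y(\mathbf c,1),\dots,Y(\mathbf c,r))$, where the $h_{\mathbf c}:\mathbb R^r\to\mathbb R^q$ are Borel maps and $Y$ is the real-valued process on $\mathcal X$ with $$P\{Y(x_1)\le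 t_1,\dots,Y(x_d)\le t_d\}=\psi_{x_1,\dots,x_d}\bigl(M_{x_1}(t_1),\dots,M_{x_d}(t_d)\bigr)$$ for given one-dimensional distribution functions $M_x$. (For $q=r=1$ and $h_{\mathbf c}=\mathrm{id}$ this says $P\{\boldsymbol\theta(\mathbf c_1)\le t_1,\dots,\boldsymbol\theta(\mathbf c_d)\le t_d\}=\psi_{\mathbf c_1,\dots,\mathbf c_d}(G^0_{\mathbf c_1}(t_1),\dots,G^0_{\mathbf c_d}(t_d))$; for $r=q$ and $h_{\mathbf c}=\mathrm{id}$, $\Psi$ consists of the copulas of the coordinates of the process.) *The process.* On a probability space $(\Omega,\mathcal F,P)$ let $s^*_k\sim\mathrm{Beta}(1,\alpha)$, $u^*_{lk}\sim\mathrm{Beta}(1,\beta)$ and $\boldsymbol\theta^*_{lk}$ ($k,l\ge1$) be jointly independent, where each $\boldsymbol\theta^*_{lk}$ is an $S$-valued process on $\mathcal C$ with finite-dimensional distributions determined by $\Psi$ and $(G^0_{\mathbf c})$ through the same $M$ and $h$. Put $\pi^*_k=s^*_k\prod_{i<k}(1-s^*_i)$ and $w^*_{lk}=u^*_{lk}\prod_{i<l}(1-u^*_{ik})$.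 Let $F^*_k(\mathbf c,\cdot)$ and $F(\mathbf c,\cdot)$ be $\mathcal P(S)$-valued processes such that for all $\mathbf c$, all $k$ and all Borel $B\subseteq S$, almost surely $$F^*_k(\mathbf c,\omega)(B)=\sum_{l\ge1}w^*_{lk}(\omega)\,\delta_{\boldsymbol\theta^*_{lk}(\mathbf c,\omega)}(B),\qquad F(\mathbf c,\omega)(B)=\sum_{k\ge1}\pi^*_k(\omega)\,F^*_k(\mathbf c,\omega)(B).$$ The process $\{F(\mathbf c,\cdot)\}_{\mathbf c}$ is the AD-nDDP. For clusters $i$, let $F_{\mathbf c,i}=F^*_{\zeta_i}(\mathbf c,\cdot)$ for all $\mathbf c$, where each $\zeta_i$ is a random index which, given the $s^*_k$ and the $F^*_k$, equals $k$ with probability $\pi^*_k$; that is, $\{F_{\mathbf c,i}\}_{\mathbf c}$ is a draw from $\sum_k\pi^*_k\delta_{F^*_k}$. **Proposition.** If every copula in $\Psi$ has an (almost everywhere) positive density with respect to Lebesgue measure on the cube $[0,1]^d$ of its dimension, then $\mathcal P(\Theta)^{\mathcal C}=\{Q\in\mathcal P(S)^{\mathcal C}: Q_{\mathbf c}(\Theta)=1\text{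 for all }\mathbf c\}$ is the weak support of the process $\{F(\mathbf c,\cdot)\}_{\mathbf c}$, and also, for each $i$, of the process $\{F_{\mathbf c,i}\}_{\mathbf c}$. That is, with $\mathcal P(S)^{\mathcal C}$ carrying the product topology, 1. $\mathcal P(\Theta)^{\mathcal C}$ is the smallest closed subset of $\mathcal P(S)^{\mathcal C}$ that has measure one for the law of the process (for uncountable $\mathcal C$: outer measure one for its law on the product $\sigma$-algebra); 2. $Q\in\mathcal P(S)^{\mathcal C}$ belongs to $\mathcal P(\Theta)^{\mathcal C}$ if and only if the process lies in every open neighbourhood of $Q$ with positive (outer) probability. -/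

import Mathlib

open MeasureTheory ProbabilityTheory Set

/-- A `d`-dimensional copula: on the unit cube, `ψ` is the joint distribution function of a
probability measure whose one-dimensional margins are uniform on `[0, 1]`.  Only the values of
`ψ` on the cube matter. -/
def IsCopula {d : ℕ} (ψ : (Fin d → ℝ) → ℝ) : Prop :=
  ∃ μ : Measure (Fin d → ℝ), IsProbabilityMeasure μ ∧
    (∀ i, μ.map (fun u => u i) = volume.restrict (Icc (0 : ℝ) 1)) ∧
    ∀ u ∈ Icc (0 : Fin d → ℝ) 1, ψ u = μ.real (Iic u)

/-- The copula `ψ` is the integral of a measurable density with respect to Lebesgue measure on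
`[0, 1] ^ d` which is positive (almost everywhere). -/
def HasPositiveDensity {d : ℕ} (ψ : (Fin d → ℝ) → ℝ) : Prop :=
  ∃ f : (Fin d → ℝ) → ENNReal, Measurable f ∧
    (∀ᵐ u ∂(volume.restrict (Icc (0 : Fin d → ℝ) 1)), 0 < f u) ∧
    ∀ u ∈ Icc (0 : Fin d → ℝ) 1, ENNReal.ofReal (ψ u) = ∫⁻ v in Icc 0 u, f v

/-- A consistent family of copulas `ψ_{x₁,…,x_d}`, indexed by the finite tuples of distinct
points of `X`. -/
structure CopulaFamily (X : Type*) where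
  /-- the copula of the tuple `x` -/
  copula : ∀ {d : ℕ}, (Fin d ↪ X) → (Fin d → ℝ) → ℝ
  isCopula : ∀ {d : ℕ} (x : Fin d ↪ X), IsCopula (copula x)
  /-- invariance under permutations -/
  perm : ∀ {d : ℕ} (x : Fin d ↪ X) (p : Equiv.Perm (Fin d)), ∀ u ∈ Icc (0 : Fin d → ℝ) 1,
    copula (p.toEmbedding.trans x) (fun i => u (p i)) = copula x u
  /-- setting the `k`-th argument to `1` removes the `k`-th point -/
  drop : ∀ {d : ℕ} (x : Fin (d + 1) ↪ X) (k : Fin (d + 1)),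
    ∀ u ∈ Icc (0 : Fin (d + 1) → ℝ) 1, u k = 1 →
    copula x u = copula ((Fin.succAboveEmb k).trans x) (fun i => u (k.succAbove i))

/-- `ν` is the law (on `ℝ^X`, with the product σ-algebra) of a real-valued process `Y` with
`P (Y x₁ ≤ t₁, …, Y x_d ≤ t_d) = ψ_{x₁,…,x_d} (M_{x₁} (t₁), …, M_{x_d} (t_d))`,
where `M_x (t)` is the distribution function of the marginal distribution `M x`. -/
def IsCopulaProcessLaw {X : Type*} (Ψ : CopulaFamily X) (M : X → Measure ℝ)
    (ν : Measure (X → ℝ)) : Prop :=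
  IsProbabilityMeasure ν ∧ ∀ {d : ℕ} (x : Fin d ↪ X) (t : Fin d → ℝ),
    ν {y | ∀ i, y (x i) ≤ t i} = ENNReal.ofReal (Ψ.copula x (fun i => cdf (M (x i)) (t i)))

/-- The finite-dimensional distributions of the `S`-valued process `θ`, where `S ⊆ ℝ^q`, are
determined by the copulas `Ψ` and have marginals `G`.  In general the process `θ` is, in law,
`c ↦ h c (Y (c, 1), …, Y (c, r))`, where `Y` is the real-valued process with copulas `Ψ` and
one-dimensional marginals `M`.  With `r = q` and `h c` the identity, `Ψ` is the family of the
copulas of the coordinates of `θ`, and `M` consists of the coordinate marginals of `G`; for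
`q = r = 1` this reads
`P (θ c₁ ≤ t₁, …, θ c_d ≤ t_d) = ψ_{c₁,…,c_d} (G_{c₁} (t₁), …, G_{c_d} (t_d))`.
With `r = 1`, the copulas are indexed by tuples of elements of `C` and each `G c` may be any
distribution on `S`. -/
structure HasCopulaLaw {Ω C : Type*} [MeasurableSpace Ω] {q r : ℕ}
    {S : Set (EuclideanSpace ℝ (Fin q))} (P : Measure Ω)
    (Ψ : CopulaFamily (C × Fin r)) (M : C × Fin r → Measure ℝ)
    (h : C → (Fin r → ℝ) → EuclideanSpace ℝ (Fin q)) (G : C → ProbabilityMeasure S)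
    (θ : C → Ω → S) : Prop where
  measurable : ∀ c, Measurable (θ c)
  marginal : ∀ c, P.map (θ c) = (G c : Measure S)
  law : ∃ ν : Measure (C × Fin r → ℝ), IsCopulaProcessLaw Ψ M ν ∧
    P.map (fun ω c => (θ c ω : EuclideanSpace ℝ (Fin q))) =
      ν.map (fun y c => h c (fun j => y (c, j)))

/-- The stick-breaking weight `v k * ∏_{i < k} (1 - v i)`. -/
noncomputable def stickWeight (v : ℕ → ℝ) (k : ℕ) : ℝ :=
  v k * ∏ i ∈ Finset.range k, (1 - v i)

/-- The atom-dependent nested dependent Dirichlet process, with concentration parameters `α`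
(outer) and `β` (inner), and with atoms whose law is determined by the copulas `Ψ` and the
marginals `G`.  The indices `k`, `l` start at `0`. -/
structure ADnDDP {Ω C : Type*} [MeasurableSpace Ω] {q r : ℕ}
    (S : Set (EuclideanSpace ℝ (Fin q))) (P : Measure Ω) (α β : ℝ)
    (Ψ : CopulaFamily (C × Fin r)) (M : C × Fin r → Measure ℝ)
    (h : C → (Fin r → ℝ) → EuclideanSpace ℝ (Fin q)) (G : C → ProbabilityMeasure S) where
  /-- the outer stick-breaking variables -/
  s : ℕ → Ω → ℝ
  /-- the inner stick-breaking variables `u l k` -/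
  u : ℕ → ℕ → Ω → ℝ
  /-- the atom processes `θ l k` -/
  θ : ℕ → ℕ → C → Ω → S
  /-- the inner random probability measures `F*_k (c, ω)` -/
  Fstar : ℕ → C → Ω → ProbabilityMeasure S
  /-- the mixture `F (c, ω)` -/
  F : C → Ω → ProbabilityMeasure S
  s_measurable : ∀ k, Measurable (s k)
  s_mem : ∀ k ω, s k ω ∈ Icc (0 : ℝ) 1
  s_law : ∀ k, P.map (s k) = betaMeasure 1 α
  u_measurable : ∀ l k, Measurable (u l k)
  u_mem : ∀ l k ω, u l k ω ∈ Icc (0 : ℝ) 1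
  u_law : ∀ l k, P.map (u l k) = betaMeasure 1 β
  θ_law : ∀ l k, HasCopulaLaw P Ψ M h G (θ l k)
  /-- all the variables `s k` and `u l k` and all the processes `θ l k` are jointly independent -/
  indep : iIndep (fun j : ℕ ⊕ (ℕ × ℕ) ⊕ (ℕ × ℕ) => match j with
    | .inl k => MeasurableSpace.comap (s k) inferInstance
    | .inr (.inl a) => MeasurableSpace.comap (u a.1 a.2) inferInstance
    | .inr (.inr a) => MeasurableSpace.comap (fun ω c => θ a.1 a.2 c ω) MeasurableSpace.pi) P
  Fstar_measurable : ∀ k c, Measurable (Fstar k c)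
  F_measurable : ∀ c, Measurable (F c)
  Fstar_eq : ∀ k c (B : Set S), MeasurableSet B → ∀ᵐ ω ∂P,
    (Fstar k c ω : Measure S) B = ∑' l, ENNReal.ofReal (stickWeight (fun i => u i k ω) l) *
      Measure.dirac (θ l k c ω) B
  F_eq : ∀ c (B : Set S), MeasurableSet B → ∀ᵐ ω ∂P,
    (F c ω : Measure S) B = ∑' k, ENNReal.ofReal (stickWeight (fun i => s i ω) k) *
      (Fstar k c ω : Measure S) B

/-- The cluster label `ζ` is drawn from the outer weights: given the outer weights and the
measures `F*_k (c, ·)`, it takes the value `k` with probability `π_k`. -/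
structure ADnDDP.IsLabel {Ω C : Type*} [MeasurableSpace Ω] {q r : ℕ}
    {S : Set (EuclideanSpace ℝ (Fin q))} {P : Measure Ω} {α β : ℝ}
    {Ψ : CopulaFamily (C × Fin r)} {M : C × Fin r → Measure ℝ}
    {h : C → (Fin r → ℝ) → EuclideanSpace ℝ (Fin q)} {G : C → ProbabilityMeasure S}
    (D : ADnDDP S P α β Ψ M h G) (ζ : Ω → ℕ) : Prop where
  measurable : Measurable ζ
  cond : ∀ (k : ℕ) (E : Set Ω),
    MeasurableSet[(⨆ k, MeasurableSpace.comap (D.s k) inferInstance) ⊔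
      ⨆ k, ⨆ c, MeasurableSpace.comap (D.Fstar k c) inferInstance] E →
    P (E ∩ ζ ⁻¹' {k}) = ∫⁻ ω in E, ENNReal.ofReal (stickWeight (fun i => D.s i ω) k) ∂P

/-- The random distributions of a cluster with label `ζ`: a draw from
`∑_k π_k δ_{F*_k}`, simultaneously for all `c`. -/
def ADnDDP.cluster {Ω C : Type*} [MeasurableSpace Ω] {q r : ℕ}
    {S : Set (EuclideanSpace ℝ (Fin q))} {P : Measure Ω} {α β : ℝ}
    {Ψ : CopulaFamily (C × Fin r)} {M : C × Fin r → Measure ℝ}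
    {h : C → (Fin r → ℝ) → EuclideanSpace ℝ (Fin q)} {G : C → ProbabilityMeasure S}
    (D : ADnDDP S P α β Ψ M h G) (ζ : Ω → ℕ) (c : C) (ω : Ω) : ProbabilityMeasure S :=
  D.Fstar (ζ ω) c ω

/-- `W` is the weak support of the `𝒫(S)`-valued process `H`.  The space `𝒫(S)^C` carries the
product topology of the topologies of weak convergence.
First, `W` is the smallest closed set of measure one for the law of the process.  The law lives
on the product σ-algebra, which is the Borel σ-algebra when `C` is countable; for uncountable
`C`, closed sets need not belong to it, and the measure of a closed set is its outer measure.
Second, `W` consists of those points all of whose neighbourhoods have positive probability. -/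
def IsWeakSupport {Ω C T : Type*} [MeasurableSpace Ω] [TopologicalSpace T] [MeasurableSpace T]
    [OpensMeasurableSpace T] (P : Measure Ω) (H : C → Ω → ProbabilityMeasure T)
    (W : Set (C → ProbabilityMeasure T)) : Prop :=
  IsLeast {A | IsClosed A ∧ P.map (fun ω c => H c ω) A = 1} W ∧
    ∀ Q, Q ∈ W ↔ ∀ U, IsOpen U → Q ∈ U → 0 < P {ω | (fun c => H c ω) ∈ U}

/-- The set `𝒫(Θ)^C`, viewed in `𝒫(S)^C`. -/
def probOn {T : Type*} [MeasurableSpace T] (C : Type*) (Θ : Set T) :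
    Set (C → ProbabilityMeasure T) :=
  {Q | ∀ c, (Q c : Measure T) Θ = 1}

/-!
The weak support of the nested process is found from the supports of its ingredients.

*Atoms.* A copula with positive density has the same null sets in the cube as Lebesgue measure.
The coordinatewise quantile transform maps the copula measure to the law of a finite tuple of
values of `Y`, and Lebesgue measure to the product of the marginals `M x`.  Hence these two laws
have the same null sets (`IsCopulaProcessLaw.absolutelyContinuous`), also after the maps `h c` have
been applied to the blocks `(Y (c, j))_j`.  So `(θ c)_{c ∈ I}` charges a product of sets as soon as
each `G c` charges its factor (`HasCopulaLaw.measure_forall_mem_pos`), and its support is the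
product of the supports of the `G c`, which is `Θ ^ I`.

*Weights.* The beta laws charge every open set that meets `[0, 1]`, and every finite probability
vector `p` is a vector of stick-breaking weights (`exists_stickWeight_eq`), so with positive
probability the weights of a cluster are close to `p`.

*Approximation.* A weak neighbourhood of `Q ∈ 𝒫(Θ)^C` constrains finitely many integrals
`∫ f d(Q c)`.  These are approximated by `∑ l, p l * f (y l c)`, with weights that do not depend on
`c` and atoms `y l c ∈ Θ` (`exists_weights_atoms`).  By independence, with positive probability the
atoms and weights of the first cluster are close to `y` and `p` and the weight of that cluster is
close to `1`; then both `F*_0` and `F` lie in the neighbourhood (`ADnDDP.measure_weakBall_pos`).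
A cluster process coincides with `F*_0` with conditional probability `s 0 > 0`, which gives the
same conclusion for it.

Conversely, `𝒫(Θ)^C` is closed, and at each index the processes are carried by `Θ` almost surely.
Sets of the product σ-algebra depend on countably many indices only, so `𝒫(Θ)^C` has outer measure
one even if `C` is uncountable (`isWeakSupport_probOn`).
-/

/-! ### The quantile transform -/

/-- The quantile function of a distribution `m` on the line, on `(0, 1)`; its value outside
`(0, 1)` is irrelevant and set to `0`. -/
noncomputable def quantile (m : Measure ℝ) (v : ℝ) : ℝ :=
  open Classical in if v ∈ Ioo (0 : ℝ) 1 then sInf {t | v ≤ cdf m t} else 0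

/-- The Galois connection between the quantile function and the distribution function, which uses
the right continuity of the latter. -/
lemma quantile_le_iff {m : Measure ℝ} {v t : ℝ} (hv : v ∈ Ioo (0 : ℝ) 1) :
    quantile m v ≤ t ↔ v ≤ cdf m t := by
  have hne : {t | v ≤ cdf m t}.Nonempty :=
    (((tendsto_cdf_atTop m).eventually (lt_mem_nhds hv.2)).exists).imp fun _ h => le_of_lt h
  have hbd : BddBelow {t | v ≤ cdf m t} := by
    obtain ⟨a, ha⟩ := ((tendsto_cdf_atBot m).eventually (gt_mem_nhds hv.1)).exists
    refine ⟨a, fun t ht => ?_⟩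
    by_contra hta
    exact absurd (ht.trans (monotone_cdf m (not_le.1 hta).le)) (not_le.2 ha)
  rw [quantile, if_pos hv]
  refine ⟨fun h => ?_, fun h => csInf_le hbd h⟩
  have hr : Filter.Tendsto (cdf m) (nhdsWithin t (Ioi t)) (nhds (cdf m t)) :=
    ((cdf m).right_continuous t).mono_left (nhdsWithin_mono _ Ioi_subset_Ici_self)
  refine ge_of_tendsto hr ?_
  filter_upwards [self_mem_nhdsWithin] with t' ht'
  obtain ⟨s, hs, hst⟩ := exists_lt_of_csInf_lt hne (lt_of_le_of_lt h ht')
  exact le_trans hs (monotone_cdf m hst.le)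

lemma measurable_quantile (m : Measure ℝ) : Measurable (quantile m) := by
  classical
  refine measurable_of_Iic fun t => ?_
  have : quantile m ⁻¹' Iic t =
      (Ioo 0 1 ∩ Iic (cdf m t)) ∪ ((Ioo 0 1)ᶜ ∩ {_v | (0 : ℝ) ≤ t}) := by
    ext v
    by_cases hv : v ∈ Ioo (0 : ℝ) 1
    · simp [quantile_le_iff hv, hv, -mem_Ioo]
    · simp [quantile, hv, -mem_Ioo]
  rw [this]
  exact (measurableSet_Ioo.inter measurableSet_Iic).union
    (measurableSet_Ioo.compl.inter (MeasurableSet.const _))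

/-- The quantile function maps the uniform distribution to `m`. -/
lemma map_quantile (m : Measure ℝ) [IsProbabilityMeasure m] :
    (volume.restrict (Icc (0 : ℝ) 1)).map (quantile m) = m := by
  refine (Measure.ext_of_Iic _ _ fun t => ?_).symm
  rw [Measure.map_apply (measurable_quantile m) measurableSet_Iic,
    ← restrict_Ioo_eq_restrict_Icc,
    Measure.restrict_apply (measurable_quantile m measurableSet_Iic)]
  have h1 : quantile m ⁻¹' Iic t ∩ Ioo 0 1 = Ioo 0 1 ∩ Iic (cdf m t) := by
    ext v
    simp only [mem_inter_iff, mem_preimage, mem_Iic]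
    constructor
    · rintro ⟨a, b⟩; exact ⟨b, (quantile_le_iff b).1 a⟩
    · rintro ⟨b, a⟩; exact ⟨(quantile_le_iff b).2 a, b⟩
  have h2 : volume (Ioo 0 1 ∩ Iic (cdf m t)) = volume (Ioc 0 1 ∩ Iic (cdf m t)) :=
    measure_congr (Ioo_ae_eq_Ioc.inter (ae_eq_refl _))
  rw [h1, h2, Ioc_inter_Iic, min_eq_right (cdf_le_one m t), Real.volume_Ioc, sub_zero, ofReal_cdf]

/-! ### Processes given by copulas with positive densities -/

/-- A finite measure on `ℝ ^ d` is determined by its joint distribution function. -/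
lemma MeasureTheory.Measure.ext_of_pi_Iic {d : ℕ} {μ ν : Measure (Fin d → ℝ)} [IsFiniteMeasure μ]
    (h : ∀ t : Fin d → ℝ, μ (Iic t) = ν (Iic t)) : μ = ν := by
  have hspan : IsCountablySpanning (range (Iic : ℝ → Set ℝ)) :=
    ⟨fun n : ℕ => Iic (n : ℝ), fun n => mem_range_self _, by
      refine eq_univ_of_forall fun x => mem_iUnion.2 ?_
      obtain ⟨n, hn⟩ := exists_nat_ge x
      exact ⟨n, hn⟩⟩
  have hpi : IsPiSystem (range (Iic : ℝ → Set ℝ)) := by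
    rintro _ ⟨a, rfl⟩ _ ⟨b, rfl⟩ -
    exact ⟨a ⊓ b, Iic_inter_Iic.symm⟩
  refine Measure.ext_of_generateFrom_of_iUnion (pi univ '' pi univ fun _ => range Iic)
    (fun n : ℕ => Iic (fun _ => (n : ℝ))) ?_ (IsPiSystem.pi fun _ => hpi) ?_ ?_ ?_ ?_
  · refine (generateFrom_eq_pi (fun _ => ?_) fun _ => hspan).symm
    rw [BorelSpace.measurable_eq (α := ℝ), borel_eq_generateFrom_Iic]
  · refine eq_univ_of_forall fun x => mem_iUnion.2 ?_
    obtain ⟨n, hn⟩ := exists_nat_ge (∑ i, |x i|)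
    refine ⟨n, fun i => le_trans ?_ hn⟩
    exact (le_abs_self _).trans
      (Finset.single_le_sum (f := fun i => |x i|) (fun _ _ => abs_nonneg _) (Finset.mem_univ i))
  · intro n
    exact ⟨fun _ => Iic (n : ℝ), fun _ _ => mem_range_self _, pi_univ_Iic _⟩
  · exact fun n => measure_ne_top _ _
  · rintro _ ⟨s, hs, rfl⟩
    choose t ht using fun i => hs i (mem_univ i)
    have : pi univ s = Iic t := by
      rw [← pi_univ_Iic]
      exact congrArg (pi univ) (funext fun i => (ht i).symm)
    rw [this, h]

lemma restrict_cube_eq_pi (d : ℕ) :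
    (volume.restrict (Icc (0 : Fin d → ℝ) 1)) =
      Measure.pi fun _ : Fin d => volume.restrict (Icc (0 : ℝ) 1) := by
  rw [← pi_univ_Icc, volume_pi, Measure.restrict_pi_pi]
  rfl

lemma map_pi_quantile {d : ℕ} (m : Fin d → Measure ℝ) [∀ i, IsProbabilityMeasure (m i)] :
    (volume.restrict (Icc (0 : Fin d → ℝ) 1)).map (fun v i => quantile (m i) (v i)) =
      Measure.pi m := by
  have : ∀ i, SigmaFinite ((volume.restrict (Icc (0 : ℝ) 1)).map (quantile (m i))) := fun i => by
    rw [map_quantile]; infer_instance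
  rw [restrict_cube_eq_pi, Measure.pi_map_pi fun i => (measurable_quantile (m i)).aemeasurable]
  simp_rw [map_quantile]

/-- With positive copula densities, the law of a finite tuple of values of the process has the
same null sets as the product of the one-dimensional marginals `M`: the two are the images, under
the coordinatewise quantile transform, of the copula measure and of Lebesgue measure on the
cube. -/
lemma IsCopulaProcessLaw.absolutelyContinuous {X : Type*} {Ψ : CopulaFamily X}
    {M : X → Measure ℝ} [∀ x, IsProbabilityMeasure (M x)] {ν : Measure (X → ℝ)}
    (hν : IsCopulaProcessLaw Ψ M ν) {d : ℕ} (x : Fin d ↪ X)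
    (hx : HasPositiveDensity (Ψ.copula x)) :
    ν.map (fun y i => y (x i)) ≪ Measure.pi (fun i => M (x i)) ∧
      Measure.pi (fun i => M (x i)) ≪ ν.map (fun y i => y (x i)) := by
  obtain ⟨f, hf, hpos, hψ⟩ := hx
  have := hν.1
  set m : Fin d → Measure ℝ := fun i => M (x i)
  set lam := volume.restrict (Icc (0 : Fin d → ℝ) 1) with hlam
  set T : (Fin d → ℝ) → Fin d → ℝ := fun v i => quantile (m i) (v i)
  have hTm : Measurable T := measurable_pi_lambda _ fun i =>
    (measurable_quantile (m i)).comp (measurable_pi_apply i)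
  have hmeas : Measurable (fun (y : X → ℝ) i => y (x i)) := by fun_prop
  have : IsProbabilityMeasure (ν.map (fun y i => y (x i))) :=
    Measure.isProbabilityMeasure_map hmeas.aemeasurable
  have hIoo : ∀ᵐ v ∂lam, ∀ i, v i ∈ Ioo (0 : ℝ) 1 := by
    rw [hlam, restrict_cube_eq_pi, ae_all_iff]
    intro i
    refine (Measure.tendsto_eval_ae_ae (i := i)).eventually ?_
    rw [← restrict_Ioo_eq_restrict_Icc]
    exact ae_restrict_mem measurableSet_Ioo
  have key : ν.map (fun y i => y (x i)) = (lam.withDensity f).map T := by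
    refine Measure.ext_of_pi_Iic fun t => ?_
    have hu : (fun i => cdf (m i) (t i)) ∈ Icc (0 : Fin d → ℝ) 1 :=
      ⟨fun i => cdf_nonneg _ _, fun i => cdf_le_one _ _⟩
    rw [Measure.map_apply hmeas measurableSet_Iic, Measure.map_apply hTm measurableSet_Iic,
      withDensity_apply _ (hTm measurableSet_Iic)]
    have h1 : (T ⁻¹' Iic t : Set _) =ᵐ[lam] Iic fun i => cdf (m i) (t i) := by
      filter_upwards [hIoo] with v hv
      exact propext (forall_congr' fun i => quantile_le_iff (hv i))
    rw [Measure.restrict_congr_set h1, hlam, Measure.restrict_restrict measurableSet_Iic,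
      inter_comm, ← Ici_inter_Iic, inter_assoc, Iic_inter_Iic, inf_eq_right.2 hu.2, Ici_inter_Iic,
      ← hψ _ hu]
    exact hν.2 x t
  rw [key, ← map_pi_quantile m]
  exact ⟨(withDensity_absolutelyContinuous _ _).map hTm,
    (withDensity_absolutelyContinuous' hf.aemeasurable
      (hpos.mono fun v hv => hv.ne')).map hTm⟩

lemma map_infinitePi_comp_embedding {X : Type*} (M : X → Measure ℝ)
    [∀ x, IsProbabilityMeasure (M x)] {d : ℕ} (x : Fin d ↪ X) :
    (Measure.infinitePi M).map (fun y i => y (x i)) = Measure.pi fun i => M (x i) := by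
  have hmap : ∀ x, (Measure.infinitePi M).map (fun y => y x) = M x := fun x =>
    (measurePreserving_eval_infinitePi M x).map_eq
  have h : iIndepFun (fun x (y : X → ℝ) => y x) (Measure.infinitePi M) := by
    rw [iIndepFun_iff_map_fun_eq_infinitePi_map (by fun_prop)]
    simp_rw [hmap]
    exact Measure.map_id'
  have h' := (iIndepFun_iff_map_fun_eq_pi_map (fun i => (measurable_pi_apply _).aemeasurable)).1
    (h.precomp x.injective)
  simp_rw [hmap] at h'
  exact h'

/-- On finitely many coordinates, the law of the process and the product of its marginals have
the same null sets. -/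
lemma IsCopulaProcessLaw.measure_eq_zero_iff {X : Type*} {Ψ : CopulaFamily X}
    {M : X → Measure ℝ} [∀ x, IsProbabilityMeasure (M x)] {ν : Measure (X → ℝ)}
    (hν : IsCopulaProcessLaw Ψ M ν) {d : ℕ} (x : Fin d ↪ X)
    (hx : HasPositiveDensity (Ψ.copula x)) {A : Set (Fin d → ℝ)} (hA : MeasurableSet A) :
    ν {y | (fun i => y (x i)) ∈ A} = 0 ↔
      Measure.infinitePi M {y | (fun i => y (x i)) ∈ A} = 0 := by
  have hmeas : Measurable (fun (y : X → ℝ) i => y (x i)) := by fun_prop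
  obtain ⟨h1, h2⟩ := hν.absolutelyContinuous x hx
  rw [← map_infinitePi_comp_embedding M x] at h1 h2
  constructor
  · intro h
    have := h2 (s := A) (by rwa [Measure.map_apply hmeas hA])
    rwa [Measure.map_apply hmeas hA] at this
  · intro h
    have := h1 (s := A) (by rwa [Measure.map_apply hmeas hA])
    rwa [Measure.map_apply hmeas hA] at this

lemma IsCopulaProcessLaw.measure_forall_mem_pos {C : Type*} {r : ℕ}
    {Ψ : CopulaFamily (C × Fin r)} {M : C × Fin r → Measure ℝ}
    [∀ x, IsProbabilityMeasure (M x)] {ν : Measure (C × Fin r → ℝ)}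
    (hν : IsCopulaProcessLaw Ψ M ν)
    (hΨ : ∀ (d : ℕ) (x : Fin d ↪ C × Fin r), HasPositiveDensity (Ψ.copula x))
    (I : Finset C) {A : C → Set (Fin r → ℝ)} (hA : ∀ c, MeasurableSet (A c))
    (hpos : ∀ c ∈ I, 0 < ν {y | (fun j => y (c, j)) ∈ A c}) :
    0 < ν {y | ∀ c ∈ I, (fun j => y (c, j)) ∈ A c} := by
  -- each factor is positive under the product measure
  have h1 : ∀ c ∈ I, Measure.infinitePi (fun j => M (c, j)) (A c) ≠ 0 := by
    intro c hc h0
    let x : Fin r ↪ C × Fin r := ⟨fun j => (c, j), fun _ _ h => (Prod.ext_iff.1 h).2⟩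
    refine (hpos c hc).ne' ((hν.measure_eq_zero_iff x (hΨ _ x) (hA c)).2 ?_)
    have := map_infinitePi_comp_embedding M x
    rw [← Measure.infinitePi_eq_pi] at this
    have h2 := congrArg (fun μ => μ (A c)) this
    rw [Measure.map_apply (by fun_prop) (hA c)] at h2
    exact h2.trans h0
  have h2 : Measure.infinitePi M {y | ∀ c ∈ I, (fun j => y (c, j)) ∈ A c} ≠ 0 := by
    have h3 := congrArg (fun μ => μ ((I : Set C).pi A))
      (Measure.infinitePi_map_curry fun c j => M (c, j))
    rw [Measure.infinitePi_pi _ (fun c _ => hA c), Measure.map_apply (by fun_prop)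
      (MeasurableSet.pi I.countable_toSet fun c _ => hA c)] at h3
    have h4 := h3.trans_ne (Finset.prod_ne_zero_iff.2 h1)
    exact h4
  let e : Fin (Fintype.card (I × Fin r)) ≃ I × Fin r := (Fintype.equivFin _).symm
  let x : Fin (Fintype.card (I × Fin r)) ↪ C × Fin r :=
    ⟨fun i => ((e i).1, (e i).2), fun a b h => e.injective
      (Prod.ext (Subtype.ext (Prod.ext_iff.1 h).1) (Prod.ext_iff.1 h).2)⟩
  have hW : MeasurableSet {z : Fin (Fintype.card (I × Fin r)) → ℝ |
      ∀ c : I, (fun j => z (e.symm (c, j))) ∈ A c} := by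
    rw [ofPred_forall]
    exact MeasurableSet.iInter fun c => (hA c).preimage (by fun_prop)
  have hset : {y : C × Fin r → ℝ | (fun i => y (x i)) ∈
      {z : Fin (Fintype.card (I × Fin r)) → ℝ | ∀ c : I, (fun j => z (e.symm (c, j))) ∈ A c}} =
      {y | ∀ c ∈ I, (fun j => y (c, j)) ∈ A c} := by
    have hx : ∀ c j, x (e.symm (c, j)) = (↑c, j) := fun c j => by
      change (((e (e.symm (c, j))).1 : C), (e (e.symm (c, j))).2) = _
      rw [Equiv.apply_symm_apply]
    ext y
    simp only [mem_ofPred_eq, hx, Subtype.forall]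
  have h5 := hν.measure_eq_zero_iff x (hΨ _ x) hW
  rw [hset] at h5
  exact pos_iff_ne_zero.2 fun h => h2 (h5.1 h)

/-- The vector `(θ c)_{c ∈ I}` charges every product of sets charged by the marginals `G c`. -/
lemma HasCopulaLaw.measure_forall_mem_pos {Ω C : Type*} [MeasurableSpace Ω] {q r : ℕ}
    {S : Set (EuclideanSpace ℝ (Fin q))} {P : Measure Ω}
    {Ψ : CopulaFamily (C × Fin r)} {M : C × Fin r → Measure ℝ}
    [∀ x, IsProbabilityMeasure (M x)]
    {h : C → (Fin r → ℝ) → EuclideanSpace ℝ (Fin q)} (hh : ∀ c, Measurable (h c))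
    {G : C → ProbabilityMeasure S} {θ : C → Ω → S} (hθ : HasCopulaLaw P Ψ M h G θ)
    (hΨ : ∀ (d : ℕ) (x : Fin d ↪ C × Fin r), HasPositiveDensity (Ψ.copula x))
    (I : Finset C) {V : C → Set S} (hV : ∀ c, MeasurableSet (V c))
    (hpos : ∀ c ∈ I, 0 < (G c : Measure S) (V c)) :
    0 < P {ω | ∀ c ∈ I, θ c ω ∈ V c} := by
  choose B hB hBV using hV
  obtain ⟨ν, hν, hlaw⟩ := hθ.law
  have hθm := hθ.measurable
  have hm1 : Measurable fun ω c => (θ c ω : EuclideanSpace ℝ (Fin q)) := by fun_prop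
  have hm2 : Measurable fun (y : C × Fin r → ℝ) c => h c (fun j => y (c, j)) :=
    measurable_pi_lambda _ fun c => (hh c).comp (by fun_prop)
  have hJ : ∀ J : Finset C, P {ω | ∀ c ∈ J, θ c ω ∈ V c} =
      ν {y | ∀ c ∈ J, (fun j => y (c, j)) ∈ h c ⁻¹' B c} := by
    intro J
    have hW : MeasurableSet ((J : Set C).pi B) :=
      MeasurableSet.pi J.countable_toSet fun c _ => hB c
    have := congrArg (fun μ => μ ((J : Set C).pi B)) hlaw
    rw [Measure.map_apply hm1 hW, Measure.map_apply hm2 hW] at this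
    simp_rw [← hBV]
    exact this
  rw [hJ]
  refine hν.measure_forall_mem_pos hΨ I (fun c => hh c (hB c)) fun c hc => ?_
  have h1 := hJ {c}
  simp only [Finset.mem_singleton, forall_eq] at h1
  rw [← h1]
  have h2 := hpos c hc
  rw [← hθ.marginal c, Measure.map_apply (hθm c) (hBV c ▸ measurable_subtype_coe (hB c))] at h2
  exact h2

/-! ### The weak topology and weak supports -/

open scoped BoundedContinuousFunction NNReal

/-- The integral `∫ f dμ`, as a real number. -/
noncomputable def pairing {T : Type*} [TopologicalSpace T] [MeasurableSpace T]
    (f : T →ᵇ ℝ≥0) (μ : ProbabilityMeasure T) : ℝ :=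
  (∫⁻ x, f x ∂(μ : Measure T)).toReal

/-- The basic neighbourhood of `Q` in the product of weak topologies, given by finitely many test
functions, each at one coordinate, and by a radius. -/
def weakBall {C T : Type*} [TopologicalSpace T] [MeasurableSpace T]
    (K : Finset (C × (T →ᵇ ℝ≥0))) (ε : ℝ) (Q : C → ProbabilityMeasure T) :
    Set (C → ProbabilityMeasure T) :=
  {R | ∀ k ∈ K, |pairing k.2 (R k.1) - pairing k.2 (Q k.1)| < ε}

lemma exists_weakBall_subset {C T : Type*} [TopologicalSpace T] [MeasurableSpace T]
    [OpensMeasurableSpace T] {U : Set (C → ProbabilityMeasure T)} (hU : IsOpen U)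
    {Q : C → ProbabilityMeasure T} (hQ : Q ∈ U) :
    ∃ (K : Finset (C × (T →ᵇ ℝ≥0))) (ε : ℝ), 0 < ε ∧ weakBall K ε Q ⊆ U := by
  let Φ : (C → ProbabilityMeasure T) → C × (T →ᵇ ℝ≥0) → ℝ := fun R k => pairing k.2 (R k.1)
  have hle : Filter.comap Φ (nhds (Φ Q)) ≤ nhds Q := by
    have h : Filter.Tendsto Φ (Filter.comap Φ (nhds (Φ Q))) (nhds (Φ Q)) := Filter.tendsto_comap
    rw [tendsto_pi_nhds] at h
    refine Filter.tendsto_id'.1 (tendsto_pi_nhds.2 fun c => ?_)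
    refine ProbabilityMeasure.tendsto_iff_forall_lintegral_tendsto.2 fun f => ?_
    have hfin : ∀ μ : ProbabilityMeasure T, ∫⁻ x, f x ∂(μ : Measure T) ≠ ⊤ := fun μ =>
      (BoundedContinuousFunction.lintegral_lt_top_of_nnreal (μ : Measure T) f).ne
    exact (ENNReal.tendsto_toReal_iff (fun _ => hfin _) (hfin _)).1 (h (c, f))
  obtain ⟨V, hV, hVU⟩ := Filter.mem_comap.1 (hle (hU.mem_nhds hQ))
  rw [nhds_pi, Filter.mem_pi'] at hV
  obtain ⟨K, t, ht, htV⟩ := hV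
  have hev : ∀ᶠ ε : ℝ in nhdsWithin 0 (Ioi 0), ∀ k ∈ K, Metric.ball (Φ Q k) ε ⊆ t k := by
    rw [Filter.eventually_all_finset]
    intro k _
    obtain ⟨ε, hε, hb⟩ := Metric.mem_nhds_iff.1 (ht k)
    filter_upwards [Ioo_mem_nhdsGT hε] with δ hδ
    exact (Metric.ball_subset_ball hδ.2.le).trans hb
  obtain ⟨ε, hε, hε0⟩ := (hev.and self_mem_nhdsWithin).exists
  exact ⟨K, ε, hε0, fun R hR => hVU (htV fun k hk => hε k hk (hR k hk))⟩

lemma measurableSet_weakBall {C T : Type*} [TopologicalSpace T] [MeasurableSpace T]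
    [OpensMeasurableSpace T] (K : Finset (C × (T →ᵇ ℝ≥0))) (ε : ℝ)
    (Q : C → ProbabilityMeasure T) : MeasurableSet (weakBall K ε Q) := by
  have hm : ∀ k : C × (T →ᵇ ℝ≥0),
      Measurable fun R : C → ProbabilityMeasure T => pairing k.2 (R k.1) := fun k =>
    ((Measure.measurable_lintegral k.2.measurable_coe_ennreal_comp).comp
      (measurable_subtype_coe.comp (measurable_pi_apply k.1))).ennreal_toReal
  have : weakBall K ε Q = ⋂ k ∈ K,
      {R : C → ProbabilityMeasure T | |pairing k.2 (R k.1) - pairing k.2 (Q k.1)| < ε} := by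
    ext R; simp [weakBall]
  rw [this]
  refine Finset.measurableSet_biInter K fun k _ => measurableSet_lt ?_ measurable_const
  exact ((hm k).sub measurable_const).abs

lemma isClosed_probOn {T : Type*} (C : Type*) [TopologicalSpace T] [MeasurableSpace T]
    [OpensMeasurableSpace T] [HasOuterApproxClosed T] {Θ : Set T}
    (hΘ : Nonempty C → IsClosed Θ) : IsClosed (probOn C Θ) := by
  have h1 : Nonempty C → IsClosed {μ : ProbabilityMeasure T | (μ : Measure T) Θ = 1} := by
    intro hC
    rw [isClosed_iff_forall_filter]
    intro μ F hF hFs hFμ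
    have := ProbabilityMeasure.limsup_measure_closed_le_of_tendsto (μs := id)
      (Filter.tendsto_id'.2 hFμ) (hΘ hC)
    have h2 : F.limsup (fun ν : ProbabilityMeasure T => (ν : Measure T) Θ) = 1 := by
      rw [Filter.limsup_congr (v := fun _ => 1)
        (Filter.mem_of_superset (Filter.le_principal_iff.1 hFs) fun _ h => h)]
      exact Filter.limsup_const _
    exact le_antisymm prob_le_one (h2.symm.le.trans this)
  have : probOn C Θ = ⋂ c, (fun Q : C → ProbabilityMeasure T => Q c) ⁻¹'
      {μ : ProbabilityMeasure T | (μ : Measure T) Θ = 1} := by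
    ext Q; simp [probOn]
  rw [this]
  exact isClosed_iInter fun c => (h1 ⟨c⟩).preimage (continuous_apply c)

/-- Membership in a set of the product σ-algebra depends on countably many coordinates only. -/
lemma exists_countable_of_measurableSet_pi {C : Type*} {X : C → Type*}
    [∀ c, MeasurableSpace (X c)] {A : Set (∀ c, X c)} (hA : MeasurableSet A) :
    ∃ J : Set C, J.Countable ∧ ∀ x y, (∀ c ∈ J, x c = y c) → (x ∈ A ↔ y ∈ A) := by
  rw [MeasurableSpace.pi_eq_generateFrom_projections] at hA
  induction hA with
  | basic B hB =>
    obtain ⟨c, B, -, rfl⟩ := hB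
    exact ⟨{c}, countable_singleton c, fun x y h => by
      simp only [mem_preimage, Function.eval, h c rfl]⟩
  | empty => exact ⟨∅, countable_empty, fun _ _ _ => Iff.rfl⟩
  | compl B _ ih =>
    obtain ⟨J, hJ, h⟩ := ih
    exact ⟨J, hJ, fun x y hxy => not_congr (h x y hxy)⟩
  | iUnion f _ ih =>
    choose J hJ h using ih
    refine ⟨⋃ n, J n, countable_iUnion hJ, fun x y hxy => ?_⟩
    simp only [mem_iUnion]
    exact exists_congr fun n => h n x y fun c hc => hxy c (mem_iUnion.2 ⟨n, hc⟩)

/-- A process whose values are carried by the closed set `Θ`, almost surely at each index, and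
which meets every basic neighbourhood of every element of `𝒫(Θ)^C` with positive probability, has
`𝒫(Θ)^C` as its weak support.  (For empty `C`, the set `𝒫(Θ)^C` is a point whatever `Θ` is.) -/
lemma isWeakSupport_probOn {Ω C T : Type*} [MeasurableSpace Ω] [TopologicalSpace T]
    [MeasurableSpace T] [OpensMeasurableSpace T] [HasOuterApproxClosed T] {P : Measure Ω}
    [IsProbabilityMeasure P] {H : C → Ω → ProbabilityMeasure T} (hH : ∀ c, Measurable (H c))
    {Θ : Set T} (hΘ : Nonempty C → IsClosed Θ) (hne : (probOn C Θ).Nonempty)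
    (hmem : ∀ c, ∀ᵐ ω ∂P, (H c ω : Measure T) Θ = 1)
    (hpos : ∀ Q ∈ probOn C Θ, ∀ (K : Finset (C × (T →ᵇ ℝ≥0))) (ε : ℝ), 0 < ε →
      0 < P {ω | (fun c => H c ω) ∈ weakBall K ε Q}) :
    IsWeakSupport P H (probOn C Θ) := by
  have hHm : Measurable fun ω c => H c ω := measurable_pi_lambda _ hH
  have : IsProbabilityMeasure (P.map fun ω c => H c ω) :=
    Measure.isProbabilityMeasure_map hHm.aemeasurable
  have hclosed := isClosed_probOn C hΘ
  refine ⟨⟨⟨hclosed, ?_⟩, ?_⟩, ?_⟩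
  · set A := toMeasurable (P.map fun ω c => H c ω) (probOn C Θ) with hA
    have hAm : MeasurableSet A := measurableSet_toMeasurable _ _
    rw [← measure_toMeasurable, ← hA, Measure.map_apply hHm hAm, ← mem_ae_iff_prob_eq_one]
    swap
    · exact hHm hAm
    obtain ⟨J, hJ, hJA⟩ := exists_countable_of_measurableSet_pi hAm
    obtain ⟨Q₀, hQ₀⟩ := hne
    have hae : ∀ᵐ ω ∂P, ∀ c ∈ J, (H c ω : Measure T) Θ = 1 :=
      (ae_ball_iff hJ).2 fun c _ => hmem c
    filter_upwards [hae] with ω hω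
    classical
    -- outside `J` the path may be replaced by that of an element of `𝒫(Θ)^C`
    refine (hJA (fun c => if c ∈ J then H c ω else Q₀ c) _ fun c hc => if_pos hc).1
      (subset_toMeasurable _ _ fun c => ?_)
    by_cases hc : c ∈ J
    · simpa [hc] using hω c hc
    · simpa [hc] using hQ₀ c
  · rintro A ⟨hAc, hA1⟩ Q hQ
    by_contra hQA
    obtain ⟨K, ε, hε, hsub⟩ := exists_weakBall_subset hAc.isOpen_compl hQA
    have hm := measurableSet_weakBall K ε Q
    have h1 : P.map (fun ω c => H c ω) (weakBall K ε Q)ᶜ = 1 :=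
      le_antisymm prob_le_one (hA1.symm.le.trans
        (measure_mono (subset_compl_comm.1 hsub)))
    have h0 := (prob_compl_eq_one_iff hm).1 h1
    rw [Measure.map_apply hHm hm] at h0
    exact (hpos Q hQ K ε hε).ne' h0
  · intro Q
    refine ⟨fun hQ U hU hQU => ?_, fun hQ => ?_⟩
    · obtain ⟨K, ε, hε, hsub⟩ := exists_weakBall_subset hU hQU
      exact (hpos Q hQ K ε hε).trans_le (measure_mono fun ω hω => hsub hω)
    · by_contra hQΘ
      obtain ⟨c, hc⟩ : ∃ c, (Q c : Measure T) Θ ≠ 1 := by simpa [probOn] using hQΘ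
      have hU : IsOpen ((fun (R : C → ProbabilityMeasure T) (_ : Unit) => R c) ⁻¹'
          (probOn Unit Θ)ᶜ) :=
        (isClosed_probOn Unit fun _ => hΘ ⟨c⟩).isOpen_compl.preimage
          (continuous_pi fun _ => continuous_apply c)
      refine (hQ _ hU fun h => hc (h ())).ne' ?_
      refine measure_mono_null (fun ω hω h => hω fun _ => h) (hmem c)

/-! ### Approximation by finitely many atoms -/

/-- Finitely many weights and atoms in `Θ`, with weights that do not depend on `c`, approximate
the integrals of finitely many test functions against the measures `Q c`.  Indeed, the vector of
these integrals is the integral, against the product of the `Q c`, of the vector of the test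
functions, and so lies in the closed convex hull of the values of the latter on `Θ^C`. -/
lemma exists_weights_atoms {C T : Type*} [TopologicalSpace T] [MeasurableSpace T]
    [OpensMeasurableSpace T] {Θ : Set T} {Q : C → ProbabilityMeasure T} (hQ : Q ∈ probOn C Θ)
    (hΘ : MeasurableSet Θ) (K : Finset (C × (T →ᵇ ℝ≥0))) {ε : ℝ} (hε : 0 < ε) :
    ∃ (N : ℕ) (p : ℕ → ℝ) (y : ℕ → C → T), (∀ l, 0 ≤ p l) ∧ (∀ l, N ≤ l → p l = 0) ∧
      ∑ l ∈ Finset.range N, p l = 1 ∧ (∀ l < N, ∀ k ∈ K, y l k.1 ∈ Θ) ∧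
      ∀ k ∈ K, |∑ l ∈ Finset.range N, p l * (k.2 (y l k.1) : ℝ) - pairing k.2 (Q k.1)| < ε := by
  classical
  let lam : Measure (C → T) := Measure.infinitePi fun c => (Q c : Measure T)
  let g : (C → T) → K → ℝ := fun y k => (k.1.2 (y k.1.1) : ℝ)
  let A : Set (C → T) := {y | ∀ k ∈ K, y k.1 ∈ Θ}
  have hev : ∀ c, MeasurePreserving (fun y : C → T => y c) lam (Q c : Measure T) := fun c =>
    measurePreserving_eval_infinitePi _ c
  have hA : ∀ᵐ y ∂lam, y ∈ A := by
    refine (ae_ball_iff K.countable_toSet).2 fun k _ => ?_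
    exact (hev k.1).quasiMeasurePreserving.ae ((mem_ae_iff_prob_eq_one hΘ).2 (hQ k.1))
  have hint : ∀ k : K, Integrable (fun y => g y k) lam := by
    intro k
    have h1 : Integrable (fun x => (k.1.2 x : ℝ)) (Q k.1.1 : Measure T) :=
      BoundedContinuousFunction.integrable_of_nnreal _ _
    exact (hev k.1.1).integrable_comp_of_integrable h1
  have hmem : ∫ y, g y ∂lam ∈ closure (convexHull ℝ (g '' A)) := by
    refine (convex_convexHull ℝ _).closure.integral_mem isClosed_closure ?_
      (Integrable.of_eval hint)
    filter_upwards [hA] with y hy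
    exact subset_closure (subset_convexHull ℝ _ (mem_image_of_mem g hy))
  obtain ⟨v, hv, hdist⟩ := Metric.mem_closure_iff.1 hmem ε hε
  obtain ⟨ι, _, w, z, hw0, hw1, hz, rfl⟩ := mem_convexHull_iff_exists_fintype.1 hv
  choose y hyA hyz using hz
  obtain ⟨y₀, -⟩ := hA.exists
  let e := Fintype.equivFin ι
  let N := Fintype.card ι
  have hsum : ∀ F : ι → ℝ, ∑ l ∈ Finset.range N,
      (if h : l < N then F (e.symm ⟨l, h⟩) else 0) = ∑ i, F i := by
    intro F
    rw [Finset.sum_range, ← e.symm.sum_comp]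
    exact Finset.sum_congr rfl fun i _ => by simp
  refine ⟨N, fun l => if h : l < N then w (e.symm ⟨l, h⟩) else 0,
    fun l => if h : l < N then y (e.symm ⟨l, h⟩) else y₀, fun l => ?_, fun l hl => ?_, ?_, ?_, ?_⟩
  · dsimp only
    split_ifs
    · exact hw0 _
    · exact le_rfl
  · simp [not_lt.2 hl]
  · exact (hsum w).trans hw1
  · intro l hl k hk
    simpa [hl] using hyA (e.symm ⟨l, hl⟩) k hk
  · intro k hk
    have h1 : ∑ l ∈ Finset.range N, (if h : l < N then w (e.symm ⟨l, h⟩) else 0) *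
        (k.2 ((if h : l < N then y (e.symm ⟨l, h⟩) else y₀) k.1) : ℝ) =
        ∑ i, w i * (k.2 (y i k.1) : ℝ) := by
      rw [← hsum]
      refine Finset.sum_congr rfl fun l hl => ?_
      simp [Finset.mem_range.1 hl]
    have h2 : (∫ y, g y ∂lam) ⟨k, hk⟩ = pairing k.2 (Q k.1) := by
      rw [eval_integral hint]
      change ∫ y, (k.2 (y k.1) : ℝ) ∂lam = _
      rw [pairing, BoundedContinuousFunction.toReal_lintegral_coe_eq_integral,
        ← (hev k.1).map_eq, integral_map (hev k.1).measurable.aemeasurable]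
      exact (k.2.continuous.measurable.coe_nnreal_real).aestronglyMeasurable
    have h3 := (dist_le_pi_dist _ _ (⟨k, hk⟩ : K)).trans_lt hdist
    rw [h1]
    rw [h2, dist_comm, Real.dist_eq, Finset.sum_apply] at h3
    simpa [← hyz, g] using h3

/-! ### Stick-breaking weights -/

lemma stickWeight_nonneg {v : ℕ → ℝ} (hv : ∀ i, v i ∈ Icc (0 : ℝ) 1) (k : ℕ) :
    0 ≤ stickWeight v k :=
  mul_nonneg (hv k).1 (Finset.prod_nonneg fun i _ => sub_nonneg.2 (hv i).2)

lemma stickWeight_zero (v : ℕ → ℝ) : stickWeight v 0 = v 0 := by simp [stickWeight]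

lemma continuous_stickWeight (l : ℕ) : Continuous fun v : ℕ → ℝ => stickWeight v l := by
  unfold stickWeight
  fun_prop

/-- Every probability vector `p` is a vector of stick-breaking weights.  The breaks are
`p l / (1 - ∑_{j < l} p j)`, which is `0` once the stick is used up. -/
lemma exists_stickWeight_eq {p : ℕ → ℝ} (hp : ∀ l, 0 ≤ p l)
    (hp1 : ∀ n, ∑ j ∈ Finset.range n, p j ≤ 1) :
    ∃ v : ℕ → ℝ, (∀ l, v l ∈ Icc (0 : ℝ) 1) ∧ ∀ l, stickWeight v l = p l := by
  have hle : ∀ l, p l ≤ 1 - ∑ j ∈ Finset.range l, p j := fun l => by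
    have := hp1 (l + 1)
    rw [Finset.sum_range_succ] at this
    linarith
  have hmul : ∀ l, p l / (1 - ∑ j ∈ Finset.range l, p j) * (1 - ∑ j ∈ Finset.range l, p j) =
      p l := fun l => by
    rcases eq_or_ne (1 - ∑ j ∈ Finset.range l, p j) 0 with h | h
    · rw [h, mul_zero]
      exact le_antisymm (hp l) (h ▸ hle l)
    · exact div_mul_cancel₀ _ h
  refine ⟨fun l => p l / (1 - ∑ j ∈ Finset.range l, p j), fun l =>
    ⟨div_nonneg (hp l) (sub_nonneg.2 (hp1 l)),
      div_le_one_of_le₀ (hle l) (sub_nonneg.2 (hp1 l))⟩, fun l => ?_⟩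
  have hprod : ∀ n, ∏ i ∈ Finset.range n, (1 - p i / (1 - ∑ j ∈ Finset.range i, p j)) =
      1 - ∑ j ∈ Finset.range n, p j := by
    intro n
    induction n with
    | zero => simp
    | succ n ih =>
      rw [Finset.prod_range_succ, ih, Finset.sum_range_succ]
      linarith [hmul n]
  rw [stickWeight, hprod, hmul]

lemma betaMeasure_pos {β : ℝ} (hβ : 0 < β) {O : Set ℝ} (hO : IsOpen O)
    (hne : (O ∩ Icc 0 1).Nonempty) : 0 < betaMeasure 1 β O := by
  have hne' : (O ∩ Ioo (0 : ℝ) 1).Nonempty := by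
    obtain ⟨x, hxO, hx⟩ := hne
    rw [← closure_Ioo (zero_ne_one' ℝ)] at hx
    exact mem_closure_iff.1 hx O hO hxO
  rw [betaMeasure, withDensity_apply _ hO.measurableSet,
    setLIntegral_pos_iff (f := betaPDF 1 β) (measurable_betaPDFReal 1 β).ennreal_ofReal]
  refine ((hO.inter isOpen_Ioo).measure_pos volume hne').trans_le (measure_mono ?_)
  rintro x ⟨hxO, hx⟩
  exact ⟨(ENNReal.ofReal_pos.2 (betaPDFReal_pos hx.1 hx.2 one_pos hβ)).ne', hxO⟩

/-! ### Integrals against mixtures -/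

/-- Cutting off a mixture of bounded quantities after `N` terms. -/
lemma abs_toReal_tsum_sub_sum_le {w : ℕ → ℝ} (hw : ∀ l, 0 ≤ w l)
    (hw1 : ∑' l, ENNReal.ofReal (w l) = 1) {a : ℕ → ENNReal} {B : ℝ≥0} (ha : ∀ l, a l ≤ B)
    (N : ℕ) :
    |(∑' l, ENNReal.ofReal (w l) * a l).toReal - ∑ l ∈ Finset.range N, w l * (a l).toReal| ≤
      B * (1 - ∑ l ∈ Finset.range N, w l) := by
  have hs : Summable w := by
    have := ENNReal.summable_toReal (f := fun l => ENNReal.ofReal (w l)) (by simp [hw1])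
    simpa [hw] using this
  have hsum : ∑' l, w l = 1 := by
    rw [← ENNReal.ofReal_tsum_of_nonneg hw hs] at hw1
    simpa using hw1
  have haB : ∀ l, (a l).toReal ≤ B := fun l => ENNReal.toReal_le_coe_of_le_coe (ha l)
  have hle : ∀ l, w l * (a l).toReal ≤ B * w l := fun l => by
    rw [mul_comm]
    exact mul_le_mul_of_nonneg_right (haB l) (hw l)
  have h0 : ∀ l, 0 ≤ w l * (a l).toReal := fun l => mul_nonneg (hw l) ENNReal.toReal_nonneg
  have hs' : Summable fun l => w l * (a l).toReal :=
    Summable.of_nonneg_of_le h0 hle (hs.mul_left _)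
  have heq : (∑' l, ENNReal.ofReal (w l) * a l).toReal = ∑' l, w l * (a l).toReal := by
    rw [ENNReal.tsum_toReal_eq fun l =>
      ENNReal.mul_ne_top ENNReal.ofReal_ne_top (ne_top_of_le_ne_top ENNReal.coe_ne_top (ha l))]
    simp [hw]
  have htail : 1 - ∑ l ∈ Finset.range N, w l = ∑' l, w (l + N) := by
    rw [← hsum, ← hs.sum_add_tsum_nat_add N]
    ring
  rw [heq, ← hs'.sum_add_tsum_nat_add N, add_sub_cancel_left, htail, ← tsum_mul_left,
    abs_of_nonneg (tsum_nonneg fun l => h0 _)]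
  exact Summable.tsum_le_tsum (fun l => hle _) ((summable_nat_add_iff N).2 hs')
    (((summable_nat_add_iff N).2 hs).mul_left _)

/-- Two mixtures are close if the first `N` weights and components are: as the weights `p` sum to
`1` over `l < N`, the weights `w` have mass at most `η` left beyond `N`. -/
lemma abs_toReal_tsum_sub_sum_le_of_close {w : ℕ → ℝ} (hw : ∀ l, 0 ≤ w l)
    (hw1 : ∑' l, ENNReal.ofReal (w l) = 1) {a : ℕ → ℝ≥0} {B : ℝ≥0} (ha : ∀ l, a l ≤ B)
    {p : ℕ → ℝ} (hp : ∀ l, 0 ≤ p l) {N : ℕ} (hp1 : ∑ l ∈ Finset.range N, p l = 1) {η : ℝ}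
    (hη : ∑ l ∈ Finset.range N, |w l - p l| ≤ η) {b : ℕ → ℝ} {δ : ℝ}
    (hb : ∀ l < N, |(a l : ℝ) - b l| ≤ δ) :
    |(∑' l, ENNReal.ofReal (w l) * a l).toReal - ∑ l ∈ Finset.range N, p l * b l| ≤
      2 * B * η + δ := by
  have h1 := abs_toReal_tsum_sub_sum_le hw hw1 (a := fun l => (a l : ENNReal))
    (fun l => ENNReal.coe_le_coe.2 (ha l)) N
  simp only [ENNReal.coe_toReal] at h1
  have h2 : 1 - ∑ l ∈ Finset.range N, w l ≤ η := by
    rw [← hp1, ← Finset.sum_sub_distrib]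
    refine le_trans (Finset.sum_le_sum fun l _ => ?_) hη
    rw [abs_sub_comm]
    exact le_abs_self _
  have h3 : |∑ l ∈ Finset.range N, w l * (a l : ℝ) - ∑ l ∈ Finset.range N, p l * b l| ≤
      B * η + δ := by
    rw [← Finset.sum_sub_distrib]
    refine (Finset.abs_sum_le_sum_abs _ _).trans ?_
    have h4 : ∀ l ∈ Finset.range N, |w l * (a l : ℝ) - p l * b l| ≤
        B * |w l - p l| + p l * δ := by
      intro l hl
      have : w l * (a l : ℝ) - p l * b l = (a l : ℝ) * (w l - p l) + p l * ((a l : ℝ) - b l) := by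
        ring
      rw [this]
      refine (abs_add_le _ _).trans (add_le_add ?_ ?_)
      · rw [abs_mul, abs_of_nonneg (NNReal.coe_nonneg _)]
        exact mul_le_mul_of_nonneg_right (NNReal.coe_le_coe.2 (ha l)) (abs_nonneg _)
      · rw [abs_mul, abs_of_nonneg (hp l)]
        exact mul_le_mul_of_nonneg_left (hb l (Finset.mem_range.1 hl)) (hp l)
    refine (Finset.sum_le_sum h4).trans ?_
    rw [Finset.sum_add_distrib, ← Finset.mul_sum, ← Finset.sum_mul, hp1, one_mul]
    gcongr
  have h5 : (B : ℝ) * (1 - ∑ l ∈ Finset.range N, w l) ≤ B * η :=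
    mul_le_mul_of_nonneg_left h2 B.coe_nonneg
  have h6 := abs_sub_le (∑' l, ENNReal.ofReal (w l) * (a l : ENNReal)).toReal
    (∑ l ∈ Finset.range N, w l * (a l : ℝ)) (∑ l ∈ Finset.range N, p l * b l)
  linarith

/-- Random measures that agree almost surely on each measurable set give almost surely the same
integral to each nonnegative measurable function. -/
lemma ae_lintegral_eq_of_forall_ae_apply_eq {Ω T : Type*} [MeasurableSpace Ω] [MeasurableSpace T]
    {P : Measure Ω} {μ ν : Ω → Measure T}
    (h : ∀ B, MeasurableSet B → ∀ᵐ ω ∂P, μ ω B = ν ω B) {f : T → ENNReal} (hf : Measurable f) :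
    ∀ᵐ ω ∂P, ∫⁻ x, f x ∂(μ ω) = ∫⁻ x, f x ∂(ν ω) := by
  refine Measurable.ennreal_induction
    (motive := fun f => ∀ᵐ ω ∂P, ∫⁻ x, f x ∂(μ ω) = ∫⁻ x, f x ∂(ν ω)) ?_ ?_ ?_ hf
  · intro c s hs
    filter_upwards [h s hs] with ω hω
    rw [lintegral_indicator_const hs, lintegral_indicator_const hs, hω]
  · intro f g _ hf _ ihf ihg
    filter_upwards [ihf, ihg] with ω h1 h2
    simp only [Pi.add_apply]
    rw [lintegral_add_left hf, lintegral_add_left hf, h1, h2]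
  · intro f hf hmono ih
    filter_upwards [ae_all_iff.2 ih] with ω hω
    rw [lintegral_iSup hf hmono, lintegral_iSup hf hmono]
    simp_rw [hω]

/-- A random probability measure given, on each set, as a mixture of random measures is also such
a mixture on test functions. -/
lemma ae_pairing_eq_of_mixture {Ω T : Type*} [MeasurableSpace Ω] [TopologicalSpace T]
    [MeasurableSpace T] [OpensMeasurableSpace T] {P : Measure Ω} {F : Ω → ProbabilityMeasure T}
    {w : ℕ → Ω → ENNReal} {μ : ℕ → Ω → Measure T}
    (h : ∀ B, MeasurableSet B → ∀ᵐ ω ∂P, (F ω : Measure T) B = ∑' l, w l ω * μ l ω B)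
    (f : T →ᵇ ℝ≥0) :
    ∀ᵐ ω ∂P, pairing f (F ω) = (∑' l, w l ω * ∫⁻ x, f x ∂(μ l ω)).toReal := by
  have h1 := ae_lintegral_eq_of_forall_ae_apply_eq (P := P) (μ := fun ω => (F ω : Measure T))
    (ν := fun ω => Measure.sum fun l => w l ω • μ l ω)
    (fun B hB => (h B hB).mono fun ω hω => by
      rw [hω, Measure.sum_apply _ hB]
      simp) f.measurable_coe_ennreal_comp
  filter_upwards [h1] with ω hω
  rw [pairing, hω, lintegral_sum_measure]
  simp_rw [lintegral_smul_measure, smul_eq_mul]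

/-! ### The nested process -/

section ADnDDP

variable {Ω C : Type*} [MeasurableSpace Ω] {P : Measure Ω} {q r : ℕ}
  {S : Set (EuclideanSpace ℝ (Fin q))} {α β : ℝ} {Ψ : CopulaFamily (C × Fin r)}
  {M : C × Fin r → Measure ℝ} {h : C → (Fin r → ℝ) → EuclideanSpace ℝ (Fin q)}
  {G : C → ProbabilityMeasure S} {Θ : Set S}

lemma ADnDDP.ae_Fstar_apply_eq_one (D : ADnDDP S P α β Ψ M h G)
    (hΘ : ∀ c, (G c : Measure S).support = Θ) (c : C) :
    ∀ᵐ ω ∂P, ∀ k, (D.Fstar k c ω : Measure S) Θ = 1 := by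
  have hΘm : MeasurableSet Θ := hΘ c ▸ Measure.isClosed_support.measurableSet
  rw [ae_all_iff]
  intro k
  have hθ : ∀ᵐ ω ∂P, ∀ l, D.θ l k c ω ∈ Θ := by
    rw [ae_all_iff]
    intro l
    have h1 : ∀ᵐ x ∂(P.map (D.θ l k c)), x ∈ Θ := by
      rw [(D.θ_law l k).marginal c, ← hΘ c]
      exact Measure.support_mem_ae
    exact ae_of_ae_map ((D.θ_law l k).measurable c).aemeasurable h1
  filter_upwards [hθ, D.Fstar_eq k c Θᶜ hΘm.compl] with ω h1 h2
  rw [← prob_compl_eq_zero_iff hΘm, h2, ENNReal.tsum_eq_zero]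
  intro l
  rw [Measure.dirac_apply' _ hΘm.compl, indicator_of_notMem (notMem_compl_iff.2 (h1 l)), mul_zero]

lemma ADnDDP.ae_F_apply_eq_one (D : ADnDDP S P α β Ψ M h G)
    (hΘ : ∀ c, (G c : Measure S).support = Θ) (c : C) :
    ∀ᵐ ω ∂P, (D.F c ω : Measure S) Θ = 1 := by
  have hΘm : MeasurableSet Θ := hΘ c ▸ Measure.isClosed_support.measurableSet
  filter_upwards [D.ae_Fstar_apply_eq_one hΘ c, D.F_eq c Θᶜ hΘm.compl] with ω h1 h2
  rw [← prob_compl_eq_zero_iff hΘm, h2, ENNReal.tsum_eq_zero]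
  intro k
  rw [(prob_compl_eq_zero_iff hΘm).2 (h1 k), mul_zero]

/-- The weights sum to one because `F*_k` has total mass one. -/
lemma ADnDDP.ae_pairing_Fstar (D : ADnDDP S P α β Ψ M h G) (k : ℕ) (c : C) (f : S →ᵇ ℝ≥0) :
    ∀ᵐ ω ∂P, (∑' l, ENNReal.ofReal (stickWeight (fun i => D.u i k ω) l) = 1) ∧
      pairing f (D.Fstar k c ω) =
        (∑' l, ENNReal.ofReal (stickWeight (fun i => D.u i k ω) l) *
          (f (D.θ l k c ω) : ENNReal)).toReal := by
  filter_upwards [D.Fstar_eq k c univ .univ,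
    ae_pairing_eq_of_mixture (fun B hB => D.Fstar_eq k c B hB) f] with ω h1 h2
  refine ⟨by simpa using h1.symm, ?_⟩
  rw [h2]
  simp_rw [lintegral_dirac' _ f.measurable_coe_ennreal_comp]

lemma ADnDDP.ae_pairing_F (D : ADnDDP S P α β Ψ M h G) (c : C) (f : S →ᵇ ℝ≥0) :
    ∀ᵐ ω ∂P, (∑' k, ENNReal.ofReal (stickWeight (fun i => D.s i ω) k) = 1) ∧
      pairing f (D.F c ω) =
        (∑' k, ENNReal.ofReal (stickWeight (fun i => D.s i ω) k) *
          ∫⁻ x, f x ∂(D.Fstar k c ω : Measure S)).toReal := by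
  filter_upwards [D.F_eq c univ .univ,
    ae_pairing_eq_of_mixture (fun B hB => D.F_eq c B hB) f] with ω h1 h2
  exact ⟨by simpa using h1.symm, h2⟩

/-- By independence, with positive probability the first outer break lies in a given
neighbourhood of `1`, the inner breaks of the first cluster lie in a given neighbourhood of a
sequence in `[0, 1]`, and finitely many atoms of the first cluster lie, at finitely many indices,
in given sets charged by the marginals. -/
lemma ADnDDP.measure_breaks_atoms_pos [IsProbabilityMeasure P] (D : ADnDDP S P α β Ψ M h G)
    (hα : 0 < α) (hβ : 0 < β) (hM : ∀ x, IsProbabilityMeasure (M x))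
    (hh : ∀ c, Measurable (h c))
    (hΨ : ∀ (d : ℕ) (x : Fin d ↪ C × Fin r), HasPositiveDensity (Ψ.copula x))
    {a : ℝ} (ha : a < 1) {U : Set (ℕ → ℝ)} (hU : IsOpen U) {v : ℕ → ℝ}
    (hv : ∀ l, v l ∈ Icc (0 : ℝ) 1) (hvU : v ∈ U) (I : Finset C) (N : ℕ) {V : ℕ → C → Set S}
    (hV : ∀ l c, MeasurableSet (V l c)) (hpos : ∀ l < N, ∀ c ∈ I, 0 < (G c : Measure S) (V l c)) :
    0 < P {ω | a < D.s 0 ω ∧ (fun l => D.u l 0 ω) ∈ U ∧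
      ∀ l < N, ∀ c ∈ I, D.θ l 0 c ω ∈ V l c} := by
  classical
  obtain ⟨L, O, hO, hOU⟩ := isOpen_pi_iff.1 hU v hvU
  let J : Finset (ℕ ⊕ (ℕ × ℕ) ⊕ (ℕ × ℕ)) :=
    ({0} : Finset ℕ).disjSum ((L.image fun l => (l, 0)).disjSum
      ((Finset.range N).image fun l => (l, 0)))
  let A : ℕ ⊕ (ℕ × ℕ) ⊕ (ℕ × ℕ) → Set Ω := fun j => match j with
    | .inl k => D.s k ⁻¹' Ioi a
    | .inr (.inl b) => D.u b.1 b.2 ⁻¹' O b.1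
    | .inr (.inr b) => (fun ω c => D.θ b.1 b.2 c ω) ⁻¹' {x | ∀ c ∈ I, x c ∈ V b.1 c}
  have hVm : ∀ l, MeasurableSet {x : C → S | ∀ c ∈ I, x c ∈ V l c} := fun l =>
    MeasurableSet.pi I.countable_toSet fun c _ => hV l c
  have hprod := D.indep.meas_biInter (S := J) (s := A) (by
    intro j hj
    rcases j with k | b | b
    · exact ⟨Ioi a, measurableSet_Ioi, rfl⟩
    · have hb : b.1 ∈ L := by
        simp only [J, Finset.inr_mem_disjSum, Finset.inl_mem_disjSum, Finset.mem_image] at hj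
        obtain ⟨l, hl, rfl⟩ := hj
        exact hl
      exact ⟨O b.1, (hO _ hb).1.measurableSet, rfl⟩
    · exact ⟨_, hVm b.1, rfl⟩)
  have hne : ∏ j ∈ J, P (A j) ≠ 0 := by
    refine Finset.prod_ne_zero_iff.2 fun j hj => ?_
    rcases j with k | b | b
    · change P (D.s k ⁻¹' Ioi a) ≠ 0
      rw [← Measure.map_apply (D.s_measurable k) measurableSet_Ioi, D.s_law]
      exact (betaMeasure_pos hα isOpen_Ioi ⟨1, ha, zero_le_one, le_rfl⟩).ne'
    · simp only [J, Finset.inr_mem_disjSum, Finset.inl_mem_disjSum, Finset.mem_image] at hj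
      obtain ⟨l, hl, rfl⟩ := hj
      change P (D.u l 0 ⁻¹' O l) ≠ 0
      rw [← Measure.map_apply (D.u_measurable l 0) (hO l hl).1.measurableSet, D.u_law]
      exact (betaMeasure_pos hβ (hO l hl).1 ⟨v l, (hO l hl).2, hv l⟩).ne'
    · simp only [J, Finset.inr_mem_disjSum, Finset.mem_image] at hj
      obtain ⟨l, hl, rfl⟩ := hj
      exact ((D.θ_law l 0).measure_forall_mem_pos hh hΨ I (hV l)
        (hpos l (Finset.mem_range.1 hl))).ne'
  rw [← hprod] at hne
  refine (pos_iff_ne_zero.2 hne).trans_le (measure_mono fun ω hω => ?_)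
  have hω' : ∀ j ∈ J, ω ∈ A j := fun j hj => mem_iInter₂.1 hω j hj
  refine ⟨hω' (.inl 0) (by simp [J]), hOU fun l hl => ?_, fun l hl => ?_⟩
  · exact hω' (.inr (.inl (l, 0))) (by simpa [J] using hl)
  · exact hω' (.inr (.inr (l, 0))) (by simpa [J] using hl)

/-- With positive probability the outer weight of the first cluster is positive, and both
`F*_0` and `F` lie in a given basic neighbourhood of `Q ∈ 𝒫(Θ)^C`. -/
lemma ADnDDP.measure_weakBall_pos [IsProbabilityMeasure P] (D : ADnDDP S P α β Ψ M h G)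
    (hα : 0 < α) (hβ : 0 < β) (hM : ∀ x, IsProbabilityMeasure (M x))
    (hh : ∀ c, Measurable (h c)) (hΘ : ∀ c, (G c : Measure S).support = Θ)
    (hΨ : ∀ (d : ℕ) (x : Fin d ↪ C × Fin r), HasPositiveDensity (Ψ.copula x))
    {Q : C → ProbabilityMeasure S} (hQ : Q ∈ probOn C Θ) (K : Finset (C × (S →ᵇ ℝ≥0)))
    {ε : ℝ} (hε : 0 < ε) :
    0 < P {ω | 0 < D.s 0 ω ∧ (fun c => D.Fstar 0 c ω) ∈ weakBall K ε Q ∧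
      (fun c => D.F c ω) ∈ weakBall K ε Q} := by
  classical
  rcases isEmpty_or_nonempty C with hC | ⟨⟨c₀⟩⟩
  · have hK : K = ∅ := Finset.eq_empty_of_forall_notMem fun k _ => hC.elim k.1
    have := D.measure_breaks_atoms_pos hα hβ hM hh hΨ one_pos isOpen_univ
      (v := 0) (fun _ => ⟨le_rfl, zero_le_one⟩) (mem_univ _) ∅ 0 (V := fun _ _ => univ)
      (fun _ _ => .univ) (by simp)
    refine this.trans_le (measure_mono fun ω hω => ⟨hω.1, ?_, ?_⟩) <;> simp [weakBall, hK]
  have hΘm : MeasurableSet Θ := hΘ c₀ ▸ Measure.isClosed_support.measurableSet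
  obtain ⟨N, p, y, hp0, hpN, hp1, hyΘ, hyQ⟩ :=
    exists_weights_atoms hQ hΘm K (ε := ε / 8) (by positivity)
  have hple : ∀ n, ∑ j ∈ Finset.range n, p j ≤ 1 := by
    intro n
    rw [← hp1]
    rcases le_total n N with hn | hn
    · exact Finset.sum_le_sum_of_subset_of_nonneg (Finset.range_mono hn) fun l _ _ => hp0 l
    · refine (Finset.sum_subset (Finset.range_mono hn) fun l _ hl => hpN l ?_).ge
      simpa using hl
  obtain ⟨v, hv, hvp⟩ := exists_stickWeight_eq hp0 hple
  -- a common bound for the test functions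
  let B : ℝ≥0 := ∑ k ∈ K, nndist k.2 0
  have hB : ∀ k ∈ K, ∀ x, k.2 x ≤ B := fun k hk x => by
    have h1 : k.2 x ≤ nndist k.2 0 := by
      have := BoundedContinuousFunction.nndist_coe_le_nndist (f := k.2) (g := 0) x
      simpa [NNReal.nndist_zero_eq_val'] using this
    exact h1.trans (Finset.single_le_sum (f := fun k : C × (S →ᵇ ℝ≥0) => nndist k.2 0)
      (fun _ _ => zero_le) hk)
  -- each of the error terms below is at most `B * η ≤ ε / 8` or at most `ε / 8`; there are four for
  -- `F*_0` and at most two more for `F`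
  let η : ℝ := ε / (8 * (B + 1))
  have hη : 0 < η := by positivity
  have hBη : (B : ℝ) * η ≤ ε / 8 := by
    have : (B : ℝ) * η = ε / 8 * (B / (B + 1)) := by
      simp only [η]
      field_simp
    rw [this]
    refine mul_le_of_le_one_right (by positivity) (div_le_one_of_le₀ (by linarith) (by positivity))
  let U : Set (ℕ → ℝ) := {u | ∑ l ∈ Finset.range N, |stickWeight u l - p l| < η}
  have hU : IsOpen U := isOpen_lt (continuous_finsetSum _ fun l _ =>
    ((continuous_stickWeight l).sub continuous_const).abs) continuous_const
  have hvU : v ∈ U := by simpa [U, hvp] using hη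
  let I : Finset C := K.image Prod.fst
  let V : ℕ → C → Set S := fun l c =>
    ⋂ k ∈ K.filter (fun k => k.1 = c), {x | |(k.2 x : ℝ) - k.2 (y l k.1)| < ε / 8}
  have hVo : ∀ l c, IsOpen (V l c) := fun l c => isOpen_biInter_finset fun k _ =>
    isOpen_lt (((NNReal.continuous_coe.comp k.2.continuous).sub continuous_const).abs)
      continuous_const
  have hVpos : ∀ l < N, ∀ c ∈ I, 0 < (G c : Measure S) (V l c) := by
    intro l hl c hc
    obtain ⟨k, hk, rfl⟩ := Finset.mem_image.1 hc
    have hy : y l k.1 ∈ (G k.1 : Measure S).support := hΘ k.1 ▸ hyΘ l hl k hk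
    refine (Measure.mem_support_iff_forall _).1 hy _ ((hVo l k.1).mem_nhds ?_)
    refine mem_iInter₂.2 fun k' hk' => ?_
    simp only [mem_ofPred_eq, (Finset.mem_filter.1 hk').2, sub_self, abs_zero]
    positivity
  have hpos := D.measure_breaks_atoms_pos hα hβ hM hh hΨ (a := max 0 (1 - η))
    (max_lt one_pos (by linarith)) hU hv hvU I N (fun l c => (hVo l c).measurableSet) hVpos
  have hae : ∀ᵐ ω ∂P, ∀ k ∈ K,
      ((∑' l, ENNReal.ofReal (stickWeight (fun i => D.u i 0 ω) l) = 1) ∧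
      pairing k.2 (D.Fstar 0 k.1 ω) =
        (∑' l, ENNReal.ofReal (stickWeight (fun i => D.u i 0 ω) l) *
          (k.2 (D.θ l 0 k.1 ω) : ENNReal)).toReal) ∧
      ((∑' j, ENNReal.ofReal (stickWeight (fun i => D.s i ω) j) = 1) ∧
      pairing k.2 (D.F k.1 ω) =
        (∑' j, ENNReal.ofReal (stickWeight (fun i => D.s i ω) j) *
          ∫⁻ x, k.2 x ∂(D.Fstar j k.1 ω : Measure S)).toReal) :=
    (ae_ball_iff K.countable_toSet).2 fun k _ =>
      (D.ae_pairing_Fstar 0 k.1 k.2).and (D.ae_pairing_F k.1 k.2)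
  refine hpos.trans_le (measure_mono_ae ?_)
  filter_upwards [hae] with ω hω hE
  obtain ⟨hs, hu, hθ⟩ := hE
  have hs1 := D.s_mem 0 ω
  have hsη : 1 - η < D.s 0 ω := (le_max_right _ _).trans_lt hs
  have hFstar : ∀ k ∈ K, |pairing k.2 (D.Fstar 0 k.1 ω) - pairing k.2 (Q k.1)| < ε / 2 := by
    intro k hk
    obtain ⟨⟨hw1, hpair⟩, -⟩ := hω k hk
    have h1 := abs_toReal_tsum_sub_sum_le_of_close
      (stickWeight_nonneg fun i => D.u_mem i 0 ω) hw1 (a := fun l => k.2 (D.θ l 0 k.1 ω))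
      (fun l => hB k hk _) hp0 hp1 (le_of_lt hu) (b := fun l => (k.2 (y l k.1) : ℝ))
      (δ := ε / 8) (fun l hl => by
        have := mem_iInter₂.1 (hθ l hl k.1 (Finset.mem_image_of_mem _ hk)) k
          (Finset.mem_filter.2 ⟨hk, rfl⟩)
        exact le_of_lt this)
    rw [← hpair] at h1
    have h2 := hyQ k hk
    have h3 := abs_sub_le (pairing k.2 (D.Fstar 0 k.1 ω))
      (∑ l ∈ Finset.range N, p l * (k.2 (y l k.1) : ℝ)) (pairing k.2 (Q k.1))
    linarith
  refine ⟨(le_max_left _ _).trans_lt hs, fun k hk => (hFstar k hk).trans (by linarith),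
    fun k hk => ?_⟩
  -- `F` is within `2 B (1 - s 0)` of `F*_0`, since the latter has weight `s 0` in the mixture
  obtain ⟨-, hw1, hpair⟩ := hω k hk
  have hle : ∀ j, ∫⁻ x, k.2 x ∂(D.Fstar j k.1 ω : Measure S) ≤ B := fun j => by
    refine (lintegral_mono fun x => ENNReal.coe_le_coe.2 (hB k hk x)).trans ?_
    simp
  have h1 := abs_toReal_tsum_sub_sum_le (stickWeight_nonneg fun i => D.s_mem i ω) hw1 hle 1
  rw [← hpair] at h1
  simp only [Finset.range_one, Finset.sum_singleton, stickWeight_zero] at h1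
  change |_ - D.s 0 ω * pairing k.2 (D.Fstar 0 k.1 ω)| ≤ _ at h1
  have hA0 : 0 ≤ pairing k.2 (D.Fstar 0 k.1 ω) := ENNReal.toReal_nonneg
  have hAB : pairing k.2 (D.Fstar 0 k.1 ω) ≤ B := ENNReal.toReal_le_coe_of_le_coe (hle 0)
  have h2 : |D.s 0 ω * pairing k.2 (D.Fstar 0 k.1 ω) - pairing k.2 (D.Fstar 0 k.1 ω)| ≤
      B * (1 - D.s 0 ω) := by
    rw [abs_sub_comm, abs_of_nonneg (by nlinarith [hs1.2])]
    nlinarith [hs1.2]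
  have h3 : (B : ℝ) * (1 - D.s 0 ω) ≤ B * η :=
    mul_le_mul_of_nonneg_left (by linarith) B.coe_nonneg
  have h4 := hFstar k hk
  have h5 := abs_sub_le (pairing k.2 (D.F k.1 ω))
    (D.s 0 ω * pairing k.2 (D.Fstar 0 k.1 ω)) (pairing k.2 (D.Fstar 0 k.1 ω))
  have h6 := abs_sub_le (pairing k.2 (D.F k.1 ω)) (pairing k.2 (D.Fstar 0 k.1 ω))
    (pairing k.2 (Q k.1))
  linarith

lemma ADnDDP.measurable_cluster (D : ADnDDP S P α β Ψ M h G) {ζ : Ω → ℕ} (hζ : Measurable ζ)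
    (c : C) : Measurable (D.cluster ζ c) :=
  (measurable_from_prod_countable_right (f := fun x : ℕ × Ω => D.Fstar x.1 c x.2)
    fun k => D.Fstar_measurable k c).comp (hζ.prodMk measurable_id)

lemma measurableSet_ofPred_pi_mem {Ω C X : Type*} [MeasurableSpace X] {m : MeasurableSpace Ω}
    {H : C → Ω → X} (hH : ∀ c, MeasurableSpace.comap (H c) inferInstance ≤ m)
    {W : Set (C → X)} (hW : MeasurableSet W) : MeasurableSet {ω | (fun c => H c ω) ∈ W} :=
  (measurable_pi_lambda _ fun c => Measurable.of_comap_le (hH c)) hW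

/-- A cluster has the label `0` with conditional probability `s 0`, so that its process charges
the sets which are charged by `F*_0` on `{s 0 > 0}`. -/
lemma ADnDDP.IsLabel.measure_cluster_mem_pos {D : ADnDDP S P α β Ψ M h G} {ζ : Ω → ℕ}
    (hζ : D.IsLabel ζ) {W : Set (C → ProbabilityMeasure S)} (hW : MeasurableSet W)
    (hpos : 0 < P {ω | 0 < D.s 0 ω ∧ (fun c => D.Fstar 0 c ω) ∈ W}) :
    0 < P {ω | (fun c => D.cluster ζ c ω) ∈ W} := by
  set E : Set Ω := {ω | (fun c => D.Fstar 0 c ω) ∈ W}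
  have hEm : MeasurableSet[(⨆ k, MeasurableSpace.comap (D.s k) inferInstance) ⊔
      ⨆ k, ⨆ c, MeasurableSpace.comap (D.Fstar k c) inferInstance] E := by
    refine measurableSet_ofPred_pi_mem (fun c => le_trans ?_ le_sup_right) hW
    exact le_iSup₂_of_le (f := fun k c => MeasurableSpace.comap (D.Fstar k c) inferInstance)
      0 c le_rfl
  have h2 : 0 < P (E ∩ ζ ⁻¹' {0}) := by
    rw [hζ.cond 0 E hEm]
    simp_rw [stickWeight_zero]
    rw [setLIntegral_pos_iff (D.s_measurable 0).ennreal_ofReal]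
    refine hpos.trans_le (measure_mono fun ω hω => ⟨?_, hω.2⟩)
    exact (ENNReal.ofReal_pos.2 hω.1).ne'
  refine h2.trans_le (measure_mono fun ω hω => ?_)
  have h0 : ζ ω = 0 := hω.2
  have h3 : (fun c => D.cluster ζ c ω) = fun c => D.Fstar 0 c ω := by
    funext c
    rw [ADnDDP.cluster, h0]
  rw [mem_ofPred_eq, h3]
  exact hω.1

end ADnDDP

theorem proposition2 {Ω C ι : Type*} [MeasurableSpace Ω] {P : Measure Ω} [IsProbabilityMeasure P]
    {q r : ℕ} {S : Set (EuclideanSpace ℝ (Fin q))} {α β : ℝ} (hα : 0 < α) (hβ : 0 < β)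
    (Ψ : CopulaFamily (C × Fin r)) (M : C × Fin r → Measure ℝ)
    (hM : ∀ x, IsProbabilityMeasure (M x))
    (h : C → (Fin r → ℝ) → EuclideanSpace ℝ (Fin q)) (hh : ∀ c, Measurable (h c))
    (G : C → ProbabilityMeasure S)
    (Θ : Set S) (hΘ : ∀ c, (G c : Measure S).support = Θ)
    (D : ADnDDP S P α β Ψ M h G) (ζ : ι → Ω → ℕ) (hζ : ∀ i, D.IsLabel (ζ i))
    (hΨ : ∀ (d : ℕ) (x : Fin d ↪ C × Fin r), HasPositiveDensity (Ψ.copula x)) :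
    IsWeakSupport P D.F (probOn C Θ) ∧
      ∀ i, IsWeakSupport P (D.cluster (ζ i)) (probOn C Θ) := by
  have hne : (probOn C Θ).Nonempty := ⟨G, fun c => by
    rw [← mem_ae_iff_prob_eq_one (hΘ c ▸ Measure.isClosed_support.measurableSet), ← hΘ c]
    exact Measure.support_mem_ae⟩
  have hΘc : Nonempty C → IsClosed Θ := fun ⟨c⟩ => hΘ c ▸ Measure.isClosed_support
  refine ⟨isWeakSupport_probOn D.F_measurable hΘc hne (D.ae_F_apply_eq_one hΘ)
    fun Q hQ K ε hε => ?_, fun i => isWeakSupport_probOn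
      (D.measurable_cluster (hζ i).measurable) hΘc hne (fun c => ?_) fun Q hQ K ε hε => ?_⟩
  · exact (D.measure_weakBall_pos hα hβ hM hh hΘ hΨ hQ K hε).trans_le
      (measure_mono fun ω hω => hω.2.2)
  · exact (D.ae_Fstar_apply_eq_one hΘ c).mono fun ω hω => hω _
  · exact (hζ i).measure_cluster_mem_pos (measurableSet_weakBall K ε Q)
      ((D.measure_weakBall_pos hα hβ hM hh hΘ hΨ hQ K hε).trans_le
        (measure_mono fun ω hω => ⟨hω.1, hω.2.1⟩))
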